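/- Let $k$ be an algebraically closed field. An algebraic variety over $k$ means a reduced separated (possibly reducible) scheme of finite type over $k$. Let $g\colon X\to S$ be a morphism of algebraic varieties over $k$, and suppose there is an integer $d\ge 1$ such that for every closed point $s\in S$ the fiber $g^{-1}(s)$ is irreducible (in particular nonempty) of dimension $d$. Then every irreducible component $S'$ of $S$ is dominated by a unique irreducible component $X'$ of $X$ (that is, $\overline{g(X')}=S'$), and every irreducible component of $X$ is a union of fibers of $g$. Moreover, in each of the following three cases the map $X_i\mapsto\overline{g(X_i)}$ is a bijection from the set of irreducible components of $X$ onto the set of irreducible components of $S$: (a) $g$ is a closed morphism; in this case the inverse bijection is given by $S_i\mapsto g^{-1}(S_i)$; (b) all irreducible components of $X$ have the same dimension; (c) every irreducible component of $X$ contains a point at which $g$ is flat. -/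

import Mathlib

open AlgebraicGeometry CategoryTheory

universe u

/-- `X`, with structure morphism `p : X ⟶ Spec k`, is an algebraic variety over the field `k`:
a reduced, separated, possibly reducible scheme of finite type over `k`. -/
structure IsAlgebraicVariety (k : Type u) [Field k] {X : Scheme.{u}}
    (p : X ⟶ Spec (CommRingCat.of k)) : Prop where
  isReduced : IsReduced X
  isSeparated : IsSeparated p
  locallyOfFiniteType : LocallyOfFiniteType p
  quasiCompact : QuasiCompact p

/-- `g` is flat at the point `x`: the local homomorphism `𝒪_{S, g x} → 𝒪_{X, x}` is flat. -/
def IsFlatAt {X S : Scheme.{u}} (g : X ⟶ S) (x : X) : Prop :=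
  (g.stalkMap x).hom.Flat

/-- A subset of `X` is a union of fibers of `g`. (For a variety over an algebraically closed
field this gives the same statement on the closed points, since `g` maps closed points to closed
points.) -/
def IsUnionOfFibers {X S : Scheme.{u}} (g : X ⟶ S) (Z : Set X) : Prop :=
  ∃ T : Set S, Z = ⋃ s ∈ T, g ⁻¹' {s}

/-- The closed subset `Z` of `X` dominates the closed subset `W` of `S`: the image of `Z` is a
dense subset of `W`. -/
def Dominates {X S : Scheme.{u}} (g : X ⟶ S) (Z : Set X) (W : Set S) : Prop :=
  closure (g '' Z) = W

/-! ### Dimension of finitely generated domains over a field -/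

section RingDimension

/-! Everything rests on the dimension formula dim Z = dim closure(g(Z)) + d for each irreducible
component Z of X. The bound ≤ holds because a fiber of Z → closure(g(Z)) has dimension at least dim
Z - dim closure(g(Z)) wherever it is nonempty. For ≥, some nonempty open V of X lies in Z; over a
suitable closed point the fiber of Z has at most the generic dimension inside V, while a whole fiber
F that meets V has dimension d already in F ∩ V, because F is irreducible.

Given the formula, a closed fiber F meeting Z satisfies dim(Z ∩ F) ≥ d = dim F, so F ⊆ Z by
irreducibility. Chevalley's theorem and the density of closed points extend this to fibers over all
points: g(Z) ∩ g(Zᶜ) is constructible without closed points, hence empty. So components of X are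
unions of fibers, and comparing generic points gives the unique component dominating a given
component of S.

For the bijections it remains to see that each Z dominates a component W of S. In (a) the component
dominating W is all of g⁻¹(W), so it contains Z; in (b) the formula forces dim closure(g(Z)) = dim
W; in (c) going down for flat maps lifts the generic point of W into Z. -/

theorem ringKrullDim_le_of_isIntegral (R S : Type*) [CommRing R] [CommRing S] [Algebra R S]
    [Algebra.IsIntegral R S] : ringKrullDim S ≤ ringKrullDim R :=
  Order.krullDim_le_of_strictMono (PrimeSpectrum.comap (algebraMap R S)) fun _ _ h =>
    Ideal.IsIntegral.comap_lt_comap h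

/-- Polynomial rings over a field are Jacobson, so a maximal ideal contracts to a maximal ideal in
one variable fewer, and its height drops by exactly one. -/
theorem MvPolynomial.height_of_isMaximal (k : Type*) [Field k] (n : ℕ)
    (m : Ideal (MvPolynomial (Fin n) k)) [hm : m.IsMaximal] : m.height = n := by
  induction n with
  | zero =>
    have e := (MvPolynomial.isEmptyRingEquiv k (Fin 0)).toMulEquiv.isField (Field.toIsField k)
    let := e.toField
    rw [Ideal.eq_bot_of_prime m]
    simp
  | succ n ih =>
    let e := (MvPolynomial.finSuccEquiv k n).toRingEquiv
    have hmap : (m.comap e.symm).IsMaximal := Ideal.comap_isMaximal_of_equiv e.symm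
    have h1 : (m.comap e.symm).height = m.height := e.symm.height_comap m
    have hc : ((m.comap e.symm).under (MvPolynomial (Fin n) k)).IsMaximal :=
      Polynomial.isMaximal_comap_C_of_isJacobsonRing _
    have hl : (m.comap e.symm).LiesOver ((m.comap e.symm).under (MvPolynomial (Fin n) k)) := ⟨rfl⟩
    rw [← h1, Polynomial.height_eq_height_add_one
      ((m.comap e.symm).under (MvPolynomial (Fin n) k)) (m.comap e.symm), ih]
    simp

variable (k : Type*) [Field k]

/-- Noether normalization makes `B` finite over a polynomial ring in `n` variables. Integrality
bounds the dimension above by `n`; going down over this normal domain bounds the height of every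
maximal ideal below by `n`. -/
theorem exists_integral_isTranscendenceBasis (B : Type*) [CommRing B] [IsDomain B] [Algebra k B]
    [Algebra.FiniteType k B] :
    ∃ (n : ℕ) (x : Fin n → B), IsTranscendenceBasis k x ∧ ringKrullDim B = n ∧
      ∀ m : Ideal B, m.IsMaximal → m.height = n := by
  obtain ⟨n, g, hg, hfin⟩ := exists_finite_inj_algHom_of_fg k B
  algebraize [g.toRingHom]
  have hinj : FaithfulSMul (MvPolynomial (Fin n) k) B :=
    (faithfulSMul_iff_algebraMap_injective _ _).2 hg
  have : IsScalarTower k (MvPolynomial (Fin n) k) B := .of_algHom g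
  have hF : Module.Finite (MvPolynomial (Fin n) k) B := hfin
  have hI : Algebra.IsIntegral (MvPolynomial (Fin n) k) B := inferInstance
  have hht : ∀ m : Ideal B, m.IsMaximal → (n : ℕ∞) ≤ m.height := by
    intro m hm
    have hq : (m.under (MvPolynomial (Fin n) k)).IsMaximal := inferInstance
    have hN : IsNoetherianRing B := Algebra.FiniteType.isNoetherianRing k B
    rw [Ideal.height_eq_height_add_of_liesOver_of_hasGoingDown
      (m.under (MvPolynomial (Fin n) k)) m, MvPolynomial.height_of_isMaximal]
    exact le_self_add
  have hle : ringKrullDim B ≤ n := by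
    refine (ringKrullDim_le_of_isIntegral (MvPolynomial (Fin n) k) B).trans ?_
    rw [MvPolynomial.ringKrullDim_of_isNoetherianRing]
    simp
  have hub : ∀ m : Ideal B, m.IsMaximal → m.height ≤ (n : ℕ∞) := by
    intro m hm
    have := (Ideal.height_le_ringKrullDim_of_isPrime (I := m)).trans hle
    exact_mod_cast this
  refine ⟨n, algebraMap (MvPolynomial (Fin n) k) B ∘ MvPolynomial.X, ?_, ?_, ?_⟩
  · exact (IsTranscendenceBasis.mvPolynomial (Fin n) k).algebraMap_comp
  · refine le_antisymm hle ?_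
    obtain ⟨m, hm⟩ := Ideal.exists_maximal B
    refine le_trans ?_ (Ideal.height_le_ringKrullDim_of_isPrime (I := m))
    exact_mod_cast hht m hm
  · exact fun m hm => le_antisymm (hub m hm) (hht m hm)

theorem Ideal.height_eq_ringKrullDim_of_isMaximal (B : Type*) [CommRing B] [IsDomain B] [Algebra k B]
    [Algebra.FiniteType k B] (m : Ideal B) [hm : m.IsMaximal] :
    (m.height : WithBot ℕ∞) = ringKrullDim B := by
  obtain ⟨n, -, -, h1, h2⟩ := exists_integral_isTranscendenceBasis k B
  rw [h1, h2 m hm]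
  rfl

theorem IsTranscendenceBasis.ringKrullDim_eq {k B : Type*} [Field k] [CommRing B] [IsDomain B]
    [Algebra k B] [Algebra.FiniteType k B] {ι : Type*} [Finite ι] {x : ι → B}
    (hx : IsTranscendenceBasis k x) : ringKrullDim B = Nat.card ι := by
  obtain ⟨l, z, hz, hl, -⟩ := exists_integral_isTranscendenceBasis k B
  have h1 := congrArg Cardinal.toNat hx.lift_cardinalMk_eq_trdeg
  have h2 := congrArg Cardinal.toNat hz.lift_cardinalMk_eq_trdeg
  simp only [Cardinal.toNat_lift] at h1 h2
  rw [hl, Nat.card, h1, ← h2]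
  simp

/-- Dimension is transcendence degree, and a transcendence basis of `A` over `k` together with one
of `B` over `A` is one of `B` over `k`. -/
theorem ringKrullDim_add_natCard (A B : Type*) [CommRing A] [IsDomain A] [CommRing B] [IsDomain B]
    [Algebra k A] [Algebra k B] [Algebra A B] [IsScalarTower k A B]
    [Algebra.FiniteType k A] [Algebra.FiniteType k B]
    {ι : Type*} [Finite ι] {x : ι → B} (hx : IsTranscendenceBasis A x) :
    ringKrullDim A + Nat.card ι = ringKrullDim B := by
  obtain ⟨n, y, hy, hn, -⟩ := exists_integral_isTranscendenceBasis k A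
  rw [(hy.sumElim_comp hx).ringKrullDim_eq, hn, Nat.card_sum]
  simp [add_comm]

theorem ringKrullDim_localization_away (B : Type*) [CommRing B] [IsDomain B] [Algebra k B]
    [Algebra.FiniteType k B] (b : B) (hb : b ≠ 0) :
    ringKrullDim (Localization.Away b) = ringKrullDim B := by
  have hle := powers_le_nonZeroDivisors_of_noZeroDivisors hb
  have : IsDomain (Localization.Away b) := IsLocalization.isDomain_localization hle
  have : FaithfulSMul B (Localization.Away b) :=
    (faithfulSMul_iff_algebraMap_injective _ _).2 (IsLocalization.injective _ hle)
  have : Algebra.FiniteType k (Localization.Away b) :=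
    Algebra.FiniteType.trans (S := B) inferInstance
      (IsLocalization.finiteType_of_monoid_fg (.powers b) _)
  have : Algebra.IsAlgebraic B (Localization.Away b) :=
    IsLocalization.isAlgebraic (Localization.Away b) (Submonoid.powers b)
  obtain ⟨n, y, hy, hn, -⟩ := exists_integral_isTranscendenceBasis k B
  rw [hy.algebraMap_comp.ringKrullDim_eq, hn]
  simp

end RingDimension

/-! ### Upper and lower bounds for fiber dimension, in algebra -/

section FiberDimension

theorem MvPolynomial.krullDim_zeroLocus_map_C {A : Type*} [CommRing A] (m : Ideal A)
    [hm : m.IsMaximal] (ι : Type*) [Finite ι] :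
    Order.krullDim (PrimeSpectrum.zeroLocus
      ((m.map (MvPolynomial.C : A →+* MvPolynomial ι A) : Ideal _) : Set (MvPolynomial ι A))) =
      Nat.card ι := by
  let := Ideal.Quotient.field m
  rw [← ringKrullDim_quotient, ← ringKrullDim_eq_of_ringEquiv
    (MvPolynomial.quotientEquivQuotientMvPolynomial (σ := ι) m).toRingEquiv,
    MvPolynomial.ringKrullDim_of_isNoetherianRing, ringKrullDim_eq_zero_of_field, zero_add]

/-- Generic integrality without localizing: `r` is the product of denominators of finitely many
generators, and a power of it clears any polynomial in them. -/
theorem exists_ne_zero_smul_pow_isIntegral (R B : Type*) [CommRing R] [IsDomain R] [CommRing B]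
    [IsDomain B] [Algebra R B] [Algebra.FiniteType R B] [Algebra.IsAlgebraic R B] :
    ∃ r : R, r ≠ 0 ∧ ∀ y : B, ∃ n : ℕ, IsIntegral R (r ^ n • y) := by
  classical
  obtain ⟨s, hs⟩ := (inferInstance : Algebra.FiniteType R B)
  choose f hf hf' using fun y : B => (Algebra.IsAlgebraic.isAlgebraic (R := R) y).exists_integral_multiple
  refine ⟨∏ y ∈ s, f y, Finset.prod_ne_zero_iff.2 fun y _ => hf y, fun y => ?_⟩
  set r := ∏ y ∈ s, f y
  have hy : y ∈ Algebra.adjoin R (s : Set B) := hs ▸ Algebra.mem_top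
  induction hy using Algebra.adjoin_induction with
  | mem x hx =>
    refine ⟨1, ?_⟩
    have : r = (∏ y ∈ s.erase x, f y) * f x := (Finset.prod_erase_mul _ _ hx).symm
    rw [pow_one, this, mul_smul]
    exact (hf' x).smul _
  | algebraMap c => exact ⟨0, by simpa using isIntegral_algebraMap⟩
  | add x y _ _ hx hy =>
    obtain ⟨a, ha⟩ := hx
    obtain ⟨b, hb⟩ := hy
    refine ⟨a + b, ?_⟩
    have : r ^ (a + b) • (x + y) = r ^ b • (r ^ a • x) + r ^ a • (r ^ b • y) := by
      simp only [smul_add, smul_smul]; ring_nf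
    rw [this]
    exact (ha.smul _).add (hb.smul _)
  | mul x y _ _ hx hy =>
    obtain ⟨a, ha⟩ := hx
    obtain ⟨b, hb⟩ := hy
    refine ⟨a + b, ?_⟩
    have : r ^ (a + b) • (x * y) = (r ^ a • x) * (r ^ b • y) := by
      rw [smul_mul_smul_comm, pow_add]
    rw [this]
    exact ha.mul hb

/-- With `t` a transcendence basis of `B` over `A`, `B` becomes integral over `A[t]` once some `r`
is inverted. Away from `r`, incomparability sends chains in the fiber over `m` to chains in affine
space over `A ⧸ m`, of dimension `|t| = dim B - dim A`. -/
theorem exists_krullDim_fiber_add_le_of_isDomain (k : Type*) [Field k] (A B : Type*) [CommRing A]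
    [IsDomain A] [CommRing B] [IsDomain B] [Algebra k A] [Algebra k B] [Algebra A B]
    [IsScalarTower k A B] [Algebra.FiniteType k A] [Algebra.FiniteType k B] [FaithfulSMul A B] :
    ∃ b : B, b ≠ 0 ∧ ∀ m : Ideal A, m.IsMaximal →
      Order.krullDim {q : PrimeSpectrum B // m ≤ q.asIdeal.comap (algebraMap A B) ∧
        b ∉ q.asIdeal} + ringKrullDim A ≤ ringKrullDim B := by
  have hft : Algebra.FiniteType A B := Algebra.FiniteType.of_restrictScalars_finiteType k A B
  obtain ⟨s, hs⟩ := hft.out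
  have halg : Algebra.IsAlgebraic (Algebra.adjoin A (s : Set B)) B :=
    ⟨fun y => isAlgebraic_algebraMap (A := B)
      (⟨y, hs ▸ Algebra.mem_top⟩ : Algebra.adjoin A (s : Set B))⟩
  -- Choosing the basis among the finitely many generators makes it finite.
  obtain ⟨t, hts, ht⟩ := exists_isTranscendenceBasis_subset (R := A) (s : Set B)
  have htf : Finite t := s.finite_toSet.subset hts
  have halg' := ht.isAlgebraic
  set R := Algebra.adjoin A (Set.range ((↑) : t → B)) with hR
  have hft : Algebra.FiniteType R B := Algebra.FiniteType.of_restrictScalars_finiteType A R B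
  obtain ⟨r, hr0, hr⟩ := exists_ne_zero_smul_pow_isIntegral R B
  refine ⟨algebraMap R B r, by simpa using hr0, fun m hm => ?_⟩
  rw [← ringKrullDim_add_natCard k A B ht, add_comm]
  gcongr
  rw [← MvPolynomial.krullDim_zeroLocus_map_C m t]
  let e : MvPolynomial t A ≃ₐ[A] R := ht.1.aevalEquiv
  refine Order.krullDim_le_of_strictMono (fun q => ⟨PrimeSpectrum.comap
    ((algebraMap R B).comp (e : MvPolynomial t A →+* R)) q.1, ?_⟩) ?_
  · rw [PrimeSpectrum.mem_zeroLocus, SetLike.coe_subset_coe, Ideal.map_le_iff_le_comap]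
    refine q.2.1.trans fun a ha => ?_
    have h : e (MvPolynomial.C a) = algebraMap A R a := e.commutes a
    simpa [h, ← IsScalarTower.algebraMap_apply] using ha
  · rintro ⟨q, hq⟩ ⟨q', hq'⟩ hlt
    have hlt' : q.asIdeal < q'.asIdeal := hlt
    obtain ⟨x, hx', hx⟩ := Set.exists_of_ssubset hlt'
    obtain ⟨n, hn⟩ := hr x
    -- Since `r ∉ q`, multiplying by `r ^ n` keeps `x` outside `q` while making it integral.
    have hmem : r ^ n • x ∈ (q'.asIdeal : Set B) \ q.asIdeal := by
      rw [Algebra.smul_def, map_pow]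
      refine ⟨Ideal.mul_mem_left _ _ hx', fun h => ?_⟩
      rcases q.2.mem_or_mem h with h | h
      · exact hq.2 (q.2.mem_of_pow_mem _ h)
      · exact hx h
    have h1 := Ideal.comap_lt_comap_of_integral_mem_sdiff hlt'.le hmem hn
    obtain ⟨hle, y, hy', hy⟩ := SetLike.lt_iff_le_and_exists.1 h1
    have h2 : q.asIdeal.comap ((algebraMap R B).comp (e : MvPolynomial t A →+* R)) <
        q'.asIdeal.comap ((algebraMap R B).comp (e : MvPolynomial t A →+* R)) := by
      refine SetLike.lt_iff_le_and_exists.2 ⟨Ideal.comap_mono hlt'.le, e.symm y, ?_, ?_⟩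
      · simpa using hy'
      · simpa using hy
    exact h2

theorem exists_krullDim_fiber_add_le (k : Type*) [Field k] {A B : Type*} [CommRing A]
    [CommRing B] [Algebra k A] [Algebra k B] [Algebra A B]
    [IsScalarTower k A B] [Algebra.FiniteType k A] [Algebra.FiniteType k B]
    (P : PrimeSpectrum B) :
    ∃ b : B, b ∉ P.asIdeal ∧ ∀ m : PrimeSpectrum A, m.asIdeal.IsMaximal →
      Order.krullDim {q : PrimeSpectrum B // P ≤ q ∧
        PrimeSpectrum.comap (algebraMap A B) q = m ∧ b ∉ q.asIdeal} +
        ringKrullDim (A ⧸ P.asIdeal.comap (algebraMap A B)) ≤ ringKrullDim (B ⧸ P.asIdeal) := by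
  set p := P.asIdeal.comap (algebraMap A B) with hp
  have : P.asIdeal.LiesOver p := ⟨rfl⟩
  obtain ⟨b, hb, h⟩ := exists_krullDim_fiber_add_le_of_isDomain k (A ⧸ p) (B ⧸ P.asIdeal)
  obtain ⟨b, rfl⟩ := Ideal.Quotient.mk_surjective b
  refine ⟨b, by simpa [Ideal.Quotient.eq_zero_iff_mem] using hb, fun m hm => ?_⟩
  by_cases hpm : p ≤ m.asIdeal
  · have hmm : (m.asIdeal.map (Ideal.Quotient.mk p)).IsMaximal :=
      Ideal.IsMaximal.map_of_surjective_of_ker_le Ideal.Quotient.mk_surjective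
        (by rwa [Ideal.mk_ker])
    refine le_trans ?_ (h _ hmm)
    gcongr
    let e := P.asIdeal.primeSpectrumQuotientOrderIsoZeroLocus
    have he : ∀ q : PrimeSpectrum.zeroLocus (P.asIdeal : Set B), ∀ x : B,
        Ideal.Quotient.mk P.asIdeal x ∈ (e.symm q).asIdeal ↔ x ∈ q.1.asIdeal := by
      intro q x
      have h1 : (e (e.symm q)).1 = q.1 := by rw [e.apply_symm_apply]
      rw [← h1]
      rfl
    refine Order.krullDim_le_of_strictMono (fun q => ⟨e.symm ⟨q.1, q.2.1⟩, ?_, ?_⟩) ?_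
    · rw [Ideal.map_le_iff_le_comap]
      intro a ha
      rw [Ideal.mem_comap, Ideal.mem_comap, Ideal.Quotient.algebraMap_mk_of_liesOver, he]
      rw [← q.2.2.1] at ha
      exact ha
    · rw [he]
      exact q.2.2.2
    · intro q q' hlt
      exact e.symm.strictMono hlt
  -- If `m` does not contain `p` the fiber is empty, and its dimension `⊥` absorbs the sum.
  · have : IsEmpty {q : PrimeSpectrum B // P ≤ q ∧
        PrimeSpectrum.comap (algebraMap A B) q = m ∧ b ∉ q.asIdeal} := by
      refine ⟨fun q => hpm ?_⟩
      rw [← q.2.2.1]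
      exact Ideal.comap_mono q.2.1
    rw [Order.krullDim_eq_bot]
    simp

/-- For a maximal ideal `n` of the fiber, ht `n` ≤ ht `m` + ht (`n` modulo `m`) in the quotient
domains; heights of maximal ideals there are the full dimensions. -/
theorem ringKrullDim_quotient_le_add_krullDim_fiber (k : Type*) [Field k] {A B : Type*}
    [CommRing A] [CommRing B] [Algebra k A] [Algebra k B] [Algebra A B]
    [IsScalarTower k A B] [Algebra.FiniteType k A] [Algebra.FiniteType k B]
    (P : PrimeSpectrum B) (m : PrimeSpectrum A) (hm : m.asIdeal.IsMaximal)
    (h : ∃ q : PrimeSpectrum B, P ≤ q ∧ PrimeSpectrum.comap (algebraMap A B) q = m) :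
    ringKrullDim (B ⧸ P.asIdeal) ≤ ringKrullDim (A ⧸ P.asIdeal.comap (algebraMap A B)) +
      Order.krullDim {q : PrimeSpectrum B // P ≤ q ∧
        PrimeSpectrum.comap (algebraMap A B) q = m} := by
  set p := P.asIdeal.comap (algebraMap A B) with hp
  have : P.asIdeal.LiesOver p := ⟨rfl⟩
  obtain ⟨q, hPq, hqm⟩ := h
  obtain ⟨n, hn, hqn⟩ := Ideal.exists_le_maximal q.asIdeal q.2.ne_top
  have hPn : P.asIdeal ≤ n := le_trans hPq hqn
  have hpm : p ≤ m.asIdeal := by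
    rw [← hqm]
    exact Ideal.comap_mono hPq
  have hmn : m.asIdeal = n.comap (algebraMap A B) :=
    hm.eq_of_le (Ideal.comap_ne_top _ hn.ne_top) (by rw [← hqm]; exact Ideal.comap_mono hqn)
  set m' := m.asIdeal.map (Ideal.Quotient.mk p) with hm'
  set n' := n.map (Ideal.Quotient.mk P.asIdeal) with hn'
  have hmm : m'.IsMaximal :=
    Ideal.IsMaximal.map_of_surjective_of_ker_le Ideal.Quotient.mk_surjective
      (by rwa [Ideal.mk_ker])
  have hnn : n'.IsMaximal :=
    Ideal.IsMaximal.map_of_surjective_of_ker_le Ideal.Quotient.mk_surjective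
      (by rwa [Ideal.mk_ker])
  have hle : m' ≤ n'.comap (algebraMap (A ⧸ p) (B ⧸ P.asIdeal)) := by
    rw [hm', Ideal.map_le_iff_le_comap]
    intro a ha
    rw [Ideal.mem_comap, Ideal.mem_comap, Ideal.Quotient.algebraMap_mk_of_liesOver]
    refine Ideal.mem_map_of_mem _ ?_
    rw [hmn] at ha
    exact ha
  have hlies : n'.LiesOver m' := ⟨hmm.eq_of_le (Ideal.comap_ne_top _ hnn.ne_top) hle⟩
  have hN : IsNoetherianRing (A ⧸ p) := Algebra.FiniteType.isNoetherianRing k _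
  have hN' : IsNoetherianRing (B ⧸ P.asIdeal) := Algebra.FiniteType.isNoetherianRing k _
  rw [← Ideal.height_eq_ringKrullDim_of_isMaximal k _ n',
    ← Ideal.height_eq_ringKrullDim_of_isMaximal k _ m']
  have h1 : (n'.height : WithBot ℕ∞) ≤ m'.height + (n'.map (Ideal.Quotient.mk
      (m'.map (algebraMap (A ⧸ p) (B ⧸ P.asIdeal))))).height := by
    exact_mod_cast Ideal.height_le_height_add_of_liesOver m' n'
  refine h1.trans ?_
  gcongr
  have hne : n'.map (Ideal.Quotient.mk (m'.map (algebraMap (A ⧸ p) (B ⧸ P.asIdeal)))) ≠ ⊤ := by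
    refine (Ideal.IsMaximal.map_of_surjective_of_ker_le Ideal.Quotient.mk_surjective ?_).ne_top
    rwa [Ideal.mk_ker, Ideal.map_le_iff_le_comap]
  refine (Ideal.height_le_ringKrullDim_of_ne_top hne).trans ?_
  rw [ringKrullDim_quotient]
  refine Order.krullDim_le_of_strictMono
    (fun q => ⟨PrimeSpectrum.comap (Ideal.Quotient.mk P.asIdeal) q.1, ?_, ?_⟩) ?_
  · intro x hx
    have : Ideal.Quotient.mk P.asIdeal x = 0 := Ideal.Quotient.eq_zero_iff_mem.2 hx
    simp [this]
  · refine PrimeSpectrum.ext (hm.eq_of_le (PrimeSpectrum.isPrime _).ne_top ?_).symm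
    intro a ha
    have hq := q.2
    rw [PrimeSpectrum.mem_zeroLocus, SetLike.coe_subset_coe, Ideal.map_le_iff_le_comap] at hq
    have := hq (Ideal.mem_map_of_mem _ ha)
    rwa [Ideal.mem_comap, Ideal.Quotient.algebraMap_mk_of_liesOver] at this
  · intro q q' hlt
    exact (Ideal.primeSpectrumQuotientOrderIsoZeroLocus P.asIdeal).strictMono hlt

end FiberDimension

/-! ### Topological Krull dimension of subspaces -/

section TopologicalDimension

open TopologicalSpace Topology

variable {X Y : Type*} [TopologicalSpace X] [TopologicalSpace Y]

theorem topologicalKrullDim_mono {S T : Set X} (h : S ⊆ T) :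
    topologicalKrullDim S ≤ topologicalKrullDim T :=
  (IsEmbedding.inclusion h).isInducing.topologicalKrullDim_le

theorem Topology.IsEmbedding.topologicalKrullDim_image {f : X → Y} (hf : IsEmbedding f) (S : Set X) :
    topologicalKrullDim (f '' S) = topologicalKrullDim S :=
  (IsHomeomorph.topologicalKrullDim_eq _ (hf.homeomorphImage S).isHomeomorph).symm

/-- An open set meeting the smallest member of a chain meets every member, so the whole chain
restricts to it. -/
theorem topologicalKrullDim_le_of_forall_exists_isOpen {N : WithBot ℕ∞}
    (h : ∀ x : X, ∃ U : Set X, IsOpen U ∧ x ∈ U ∧ topologicalKrullDim U ≤ N) :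
    topologicalKrullDim X ≤ N := by
  refine iSup_le fun l => ?_
  obtain ⟨x, hx⟩ := l.head.isIrreducible.nonempty
  obtain ⟨U, hU, hxU, hN⟩ := h x
  refine le_trans ?_ hN
  let e := IrreducibleCloseds.orderIsoOfIsOpenEmbedding ((↑) : U → X) hU.isOpenEmbedding_subtypeVal
  exact le_iSup_of_le (⟨l.length, fun i => e.symm ⟨l i, ⟨x, hxU⟩, l.head_le i hx⟩,
    fun i => e.symm.strictMono (l.step i)⟩ : LTSeries (IrreducibleCloseds U)) le_rfl

/-- A chain in `G` is prolonged by `F` itself at the top. -/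
theorem topologicalKrullDim_add_one_le {F G : Set X} (hF : IsIrreducible F) (hG : IsClosed G)
    (hGF : G ⊂ F) : topologicalKrullDim G + 1 ≤ topologicalKrullDim F := by
  rcases G.eq_empty_or_nonempty with rfl | hne
  · have : IsEmpty (IrreducibleCloseds (∅ : Set X)) :=
      ⟨fun s => s.isIrreducible.nonempty.elim fun x _ => x.2⟩
    rw [topologicalKrullDim, Order.krullDim_eq_bot]
    simp
  have : Nonempty G := hne.to_subtype
  have : IrreducibleSpace F := isIrreducible_iff_irreducibleSpace.1 hF
  have : Nonempty (IrreducibleCloseds G) :=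
    ⟨⟨closure {⟨hne.some, hne.some_mem⟩}, isIrreducible_singleton.closure, isClosed_closure⟩⟩
  have hi := IsEmbedding.inclusion hGF.subset
  let φ : WithTop (IrreducibleCloseds G) → IrreducibleCloseds F := fun s =>
    WithTop.recTopCoe ⟨Set.univ, IrreducibleSpace.isIrreducible_univ F, isClosed_univ⟩
      (fun s => IrreducibleCloseds.map _ hi.continuous s) s
  rw [topologicalKrullDim, topologicalKrullDim, ← Order.krullDim_WithTop]
  refine Order.krullDim_le_of_strictMono φ (WithTop.strictMono_iff.2
    ⟨IrreducibleCloseds.map_strictMono_of_isInducing hi.isInducing, fun s => ?_⟩)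
  obtain ⟨x, hxF, hxG⟩ := Set.exists_of_ssubset hGF
  refine SetLike.lt_iff_le_and_exists.2 ⟨fun _ _ => Set.mem_univ _, ⟨x, hxF⟩, Set.mem_univ _, ?_⟩
  intro hx
  refine hxG (closure_minimal (t := ((↑) : F → X) ⁻¹' G) ?_ (hG.preimage continuous_subtype_val) hx)
  rintro _ ⟨y, -, rfl⟩
  exact y.2

theorem IsLocallyClosed.quasiSober [QuasiSober X] {T : Set X} (hT : IsLocallyClosed T) :
    QuasiSober T := by
  obtain ⟨U, Z, hU, hZ, rfl⟩ := hT
  have : QuasiSober U := hU.isOpenEmbedding_subtypeVal.quasiSober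
  exact QuasiSober.inter_of_isClosed_of_quasiSober_left U hZ

/-- A locally closed `T` is sober, so generic points match irreducible closed subsets with primes,
reversing the order. -/
theorem PrimeSpectrum.topologicalKrullDim_eq_krullDim {B : Type*} [CommRing B]
    (T : Set (PrimeSpectrum B)) (hT : IsLocallyClosed T) :
    topologicalKrullDim T = Order.krullDim T := by
  have hq : QuasiSober T := hT.quasiSober
  have hle : ∀ x y : T, x ≤ y ↔ x ⤳ y := fun x y => by
    rw [subtype_specializes_iff, ← PrimeSpectrum.le_iff_specializes, Subtype.coe_le_coe]
  rw [topologicalKrullDim]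
  refine le_antisymm ?_ ?_
  · rw [← Order.krullDim_orderDual (α := T)]
    refine Order.krullDim_le_of_strictMono
      (fun s : IrreducibleCloseds T => OrderDual.toDual s.isIrreducible.genericPoint)
      (Monotone.strictMono_of_injective (fun s t hst => ?_) fun s t hst => ?_)
    · refine OrderDual.toDual_le_toDual.2 ((hle _ _).2 ?_)
      rw [specializes_iff_mem_closure, IsIrreducible.genericPoint_closure_eq, t.isClosed.closure_eq]
      apply hst
      have := s.isIrreducible.isGenericPoint_genericPoint_closure.mem
      rwa [s.isClosed.closure_eq] at this
    · have h := congrArg (fun x : T => closure {x}) (OrderDual.toDual.injective hst)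
      simp only [IsIrreducible.genericPoint_closure_eq, s.isClosed.closure_eq,
        t.isClosed.closure_eq] at h
      exact SetLike.coe_injective h
  · rw [← Order.krullDim_orderDual (α := IrreducibleCloseds T)]
    refine Order.krullDim_le_of_strictMono
      (fun x : T => OrderDual.toDual
        (⟨closure {x}, isIrreducible_singleton.closure, isClosed_closure⟩ : IrreducibleCloseds T))
      (Monotone.strictMono_of_injective (fun x y hxy => ?_) fun x y hxy => ?_)
    · exact OrderDual.toDual_le_toDual.2 ((hle _ _).1 hxy).closure_subset
    · have h : closure {x} = closure {y} :=
        congrArg (fun s : IrreducibleCloseds T => (s : Set T)) (OrderDual.toDual.injective hxy)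
      exact (inseparable_iff_closure_eq.2 h).eq

end TopologicalDimension

/-! ### Affine charts and independence of dimension from the chart -/

section Charts

open TopologicalSpace Topology

theorem ringKrullDim_quotient_le_krullDim_notMem (k : Type*) [Field k] {B : Type*} [CommRing B]
    [Algebra k B] [Algebra.FiniteType k B] (P : PrimeSpectrum B) (b : B) (hb : b ∉ P.asIdeal) :
    ringKrullDim (B ⧸ P.asIdeal) ≤
      Order.krullDim {q : PrimeSpectrum B // P ≤ q ∧ b ∉ q.asIdeal} := by
  have hb' : Ideal.Quotient.mk P.asIdeal b ≠ 0 := by rwa [Ne, Ideal.Quotient.eq_zero_iff_mem]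
  rw [← ringKrullDim_localization_away k _ _ hb']
  set b' := Ideal.Quotient.mk P.asIdeal b
  have h : ∀ q : PrimeSpectrum (Localization.Away b'),
      b' ∉ q.asIdeal.comap (algebraMap (B ⧸ P.asIdeal) (Localization.Away b')) := fun q hq =>
    q.2.ne_top (Ideal.eq_top_of_isUnit_mem _ hq (IsLocalization.Away.algebraMap_isUnit b'))
  refine Order.krullDim_le_of_strictMono (fun q => ⟨PrimeSpectrum.comap
    (Ideal.Quotient.mk P.asIdeal) (PrimeSpectrum.comap (algebraMap _ _) q), ?_, ?_⟩) ?_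
  · intro x hx
    have : Ideal.Quotient.mk P.asIdeal x = 0 := Ideal.Quotient.eq_zero_iff_mem.2 hx
    simp [this]
  · exact h q
  · intro q q' hlt
    refine (Ideal.primeSpectrumQuotientOrderIsoZeroLocus P.asIdeal).strictMono ?_
    exact Monotone.strictMono_of_injective
      (f := PrimeSpectrum.comap (algebraMap (B ⧸ P.asIdeal) (Localization.Away b')))
      (fun _ _ h => Ideal.comap_mono h)
      (PrimeSpectrum.localization_comap_injective _ (Submonoid.powers b')) hlt

theorem PrimeSpectrum.isClosed_setOf_le {B : Type*} [CommRing B] (P : PrimeSpectrum B) :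
    IsClosed {q : PrimeSpectrum B | P ≤ q} :=
  PrimeSpectrum.isClosed_zeroLocus (P.asIdeal : Set B)

theorem PrimeSpectrum.isOpen_setOf_notMem {B : Type*} [CommRing B] (b : B) :
    IsOpen {q : PrimeSpectrum B | b ∉ q.asIdeal} :=
  (PrimeSpectrum.basicOpen b).isOpen

theorem ringKrullDim_quotient_le_topologicalKrullDim_inter (k : Type*) [Field k] {B : Type*}
    [CommRing B] [Algebra k B] [Algebra.FiniteType k B] (P : PrimeSpectrum B)
    {U : Set (PrimeSpectrum B)} (hU : IsOpen U) (hP : P ∈ U) :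
    ringKrullDim (B ⧸ P.asIdeal) ≤
      topologicalKrullDim ({q | P ≤ q} ∩ U : Set (PrimeSpectrum B)) := by
  obtain ⟨_, ⟨_, ⟨b, rfl⟩, rfl⟩, hb, hbU⟩ :=
    PrimeSpectrum.isBasis_basic_opens.exists_subset_of_mem_open hP hU
  refine (ringKrullDim_quotient_le_krullDim_notMem k P b hb).trans ?_
  have hcl : IsLocallyClosed {q : PrimeSpectrum B | P ≤ q ∧ b ∉ q.asIdeal} :=
    P.isClosed_setOf_le.isLocallyClosed.inter (PrimeSpectrum.isOpen_setOf_notMem b).isLocallyClosed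
  refine (PrimeSpectrum.topologicalKrullDim_eq_krullDim _ hcl).symm.le.trans ?_
  exact topologicalKrullDim_mono fun q hq => ⟨hq.1, hbU hq.2⟩

theorem topologicalKrullDim_setOf_le {B : Type*} [CommRing B] (P : PrimeSpectrum B) :
    topologicalKrullDim ({q | P ≤ q} : Set (PrimeSpectrum B)) = ringKrullDim (B ⧸ P.asIdeal) := by
  rw [PrimeSpectrum.topologicalKrullDim_eq_krullDim _ P.isClosed_setOf_le.isLocallyClosed,
    ringKrullDim_quotient]
  rfl

variable {X : Type*} [TopologicalSpace X]

theorem Topology.IsInducing.specializes_iff_le {B : Type*} [CommRing B] {i : PrimeSpectrum B → X}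
    (hi : IsInducing i) {P Q : PrimeSpectrum B} : i P ⤳ i Q ↔ P ≤ Q := by
  rw [hi.specializes_iff, PrimeSpectrum.le_iff_specializes]

/-- The overlap of the charts is open and contains the common point, so it already carries the full
dimension of `B ⧸ P`. -/
theorem ringKrullDim_quotient_le_of_isOpenEmbedding (k : Type*) [Field k] {B C : Type*}
    [CommRing B] [CommRing C] [Algebra k B] [Algebra.FiniteType k B]
    {i : PrimeSpectrum B → X} {j : PrimeSpectrum C → X} (hi : IsOpenEmbedding i)
    (hj : IsOpenEmbedding j) {P : PrimeSpectrum B} {Q : PrimeSpectrum C} (hPQ : i P = j Q) :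
    ringKrullDim (B ⧸ P.asIdeal) ≤ ringKrullDim (C ⧸ Q.asIdeal) := by
  refine (ringKrullDim_quotient_le_topologicalKrullDim_inter k P
    (hj.isOpen_range.preimage hi.continuous) ⟨Q, hPQ.symm⟩).trans ?_
  rw [← topologicalKrullDim_setOf_le, ← hj.isEmbedding.topologicalKrullDim_image,
    ← hi.isEmbedding.topologicalKrullDim_image]
  refine topologicalKrullDim_mono ?_
  rintro _ ⟨q, ⟨hq, ⟨r, hr⟩⟩, rfl⟩
  refine ⟨r, ?_, hr⟩
  have : i P ⤳ i q := hi.isInducing.specializes_iff_le.2 hq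
  rwa [hPQ, ← hr, hj.isInducing.specializes_iff_le] at this

/-- Every point of `X` has an open neighbourhood homeomorphic to the spectrum of a `k`-algebra of
finite type. -/
def IsLocallySpecOfFiniteType (k : Type u) [Field k] (X : Type u) [TopologicalSpace X] : Prop :=
  ∀ x : X, ∃ (B : Type u) (_ : CommRing B) (_ : Algebra k B) (_ : Algebra.FiniteType k B)
    (i : PrimeSpectrum B → X), IsOpenEmbedding i ∧ x ∈ Set.range i

/-- Locally on `X`, the map `g` is induced by a homomorphism of `k`-algebras of finite type. -/
def IsLocallySpecMapOfFiniteType (k : Type u) [Field k] {X S : Type u} [TopologicalSpace X]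
    [TopologicalSpace S] (g : X → S) : Prop :=
  ∀ (x : X) (V : Set X), IsOpen V → x ∈ V →
    ∃ (A B : Type u) (_ : CommRing A) (_ : CommRing B) (_ : Algebra k A) (_ : Algebra k B)
      (_ : Algebra A B) (_ : IsScalarTower k A B) (_ : Algebra.FiniteType k A)
      (_ : Algebra.FiniteType k B) (i : PrimeSpectrum B → X) (j : PrimeSpectrum A → S),
      IsOpenEmbedding i ∧ IsOpenEmbedding j ∧
      (∀ q, g (i q) = j (PrimeSpectrum.comap (algebraMap A B) q)) ∧
      x ∈ Set.range i ∧ Set.range i ⊆ V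

end Charts

/-! ### Fiber dimension bounds on the spaces -/

section FiberDim

open TopologicalSpace Topology

variable {k : Type u} [Field k] {X S : Type u} [TopologicalSpace X] [TopologicalSpace S]

theorem IsLocallySpecOfFiniteType.topologicalKrullDim_closure_eq
    (hX : IsLocallySpecOfFiniteType k X) {B : Type*} [CommRing B] [Algebra k B]
    [Algebra.FiniteType k B] {i : PrimeSpectrum B → X} (hi : IsOpenEmbedding i)
    (P : PrimeSpectrum B) :
    topologicalKrullDim (closure {i P}) = ringKrullDim (B ⧸ P.asIdeal) := by
  refine le_antisymm ?_ ?_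
  · refine topologicalKrullDim_le_of_forall_exists_isOpen fun x => ?_
    obtain ⟨C, _, _, _, j, hj, hx⟩ := hX x.1
    refine ⟨((↑) : closure {i P} → X) ⁻¹' Set.range j,
      hj.isOpen_range.preimage continuous_subtype_val, hx, ?_⟩
    obtain ⟨Q, hQ⟩ : i P ∈ Set.range j :=
      (specializes_iff_mem_closure.2 x.2).mem_open hj.isOpen_range hx
    rw [← IsEmbedding.subtypeVal.topologicalKrullDim_image]
    refine le_trans ?_ (ringKrullDim_quotient_le_of_isOpenEmbedding k hj hi hQ)
    rw [← topologicalKrullDim_setOf_le, ← hj.isEmbedding.topologicalKrullDim_image]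
    refine topologicalKrullDim_mono ?_
    rintro _ ⟨⟨_, hy⟩, ⟨r, rfl⟩, rfl⟩
    refine ⟨r, ?_, rfl⟩
    have : i P ⤳ j r := specializes_iff_mem_closure.2 hy
    rwa [← hQ, hj.isInducing.specializes_iff_le] at this
  · rw [← topologicalKrullDim_setOf_le, ← hi.isEmbedding.topologicalKrullDim_image]
    refine topologicalKrullDim_mono ?_
    rintro _ ⟨q, hq, rfl⟩
    exact specializes_iff_mem_closure.1 (hi.isInducing.specializes_iff_le.2 hq)

/-- A nonempty open subset of an irreducible closed subset has full dimension. -/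
theorem IsLocallySpecOfFiniteType.topologicalKrullDim_closure_inter_eq
    (hX : IsLocallySpecOfFiniteType k X) (ξ : X) {V : Set X} (hV : IsOpen V) (hξ : ξ ∈ V) :
    topologicalKrullDim (closure {ξ} ∩ V : Set X) = topologicalKrullDim (closure {ξ}) := by
  refine le_antisymm (topologicalKrullDim_mono Set.inter_subset_left) ?_
  obtain ⟨B, _, _, _, i, hi, P, rfl⟩ := hX ξ
  rw [hX.topologicalKrullDim_closure_eq hi P]
  refine (ringKrullDim_quotient_le_topologicalKrullDim_inter k P
    (hV.preimage hi.continuous) hξ).trans ?_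
  rw [← hi.isEmbedding.topologicalKrullDim_image]
  refine topologicalKrullDim_mono ?_
  rintro _ ⟨q, ⟨hq, hqV⟩, rfl⟩
  exact ⟨specializes_iff_mem_closure.1 (hi.isInducing.specializes_iff_le.2 hq), hqV⟩

/-- Finiteness allows these dimensions to be cancelled later. -/
theorem IsLocallySpecOfFiniteType.exists_topologicalKrullDim_closure_eq_natCast
    (hX : IsLocallySpecOfFiniteType k X) (ξ : X) :
    ∃ n : ℕ, topologicalKrullDim (closure {ξ}) = n := by
  obtain ⟨B, _, _, _, i, hi, P, rfl⟩ := hX ξ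
  rw [hX.topologicalKrullDim_closure_eq hi P]
  obtain ⟨n, -, -, h, -⟩ := exists_integral_isTranscendenceBasis k (B ⧸ P.asIdeal)
  exact ⟨n, h⟩

variable {g : X → S}

theorem IsLocallySpecMapOfFiniteType.topologicalKrullDim_le_add_fiber
    (hX : IsLocallySpecOfFiniteType k X) (hS : IsLocallySpecOfFiniteType k S)
    (hg : IsLocallySpecMapOfFiniteType k g) {ξ x : X} (hx : ξ ⤳ x) (hs : IsClosed {g x}) :
    topologicalKrullDim (closure {ξ}) ≤
      topologicalKrullDim (closure {g ξ}) + topologicalKrullDim (closure {ξ} ∩ g ⁻¹' {g x} : Set X) := by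
  obtain ⟨A, B, _, _, _, _, _, _, _, _, i, j, hi, hj, hc, hxi, -⟩ := hg x Set.univ isOpen_univ trivial
  obtain ⟨P, rfl⟩ := hx.mem_open hi.isOpen_range hxi
  obtain ⟨q₀, rfl⟩ := hxi
  rw [hi.isInducing.specializes_iff_le] at hx
  rw [hc] at hs
  have hm : IsClosed {PrimeSpectrum.comap (algebraMap A B) q₀} := by
    have := hs.preimage hj.continuous
    rwa [← Set.image_singleton, Set.preimage_image_eq _ hj.injective] at this
  rw [hX.topologicalKrullDim_closure_eq hi, hc, hS.topologicalKrullDim_closure_eq hj]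
  refine (ringKrullDim_quotient_le_add_krullDim_fiber k P _
    ((PrimeSpectrum.isClosed_singleton_iff_isMaximal _).1 hm) ⟨q₀, hx, rfl⟩).trans ?_
  refine add_le_add le_rfl ?_
  have hcl : IsClosed {q : PrimeSpectrum B | P ≤ q ∧ PrimeSpectrum.comap (algebraMap A B) q =
      PrimeSpectrum.comap (algebraMap A B) q₀} :=
    P.isClosed_setOf_le.inter (hm.preimage (PrimeSpectrum.continuous_comap _))
  refine (PrimeSpectrum.topologicalKrullDim_eq_krullDim _ hcl.isLocallyClosed).symm.le.trans ?_
  rw [← hi.isEmbedding.topologicalKrullDim_image]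
  refine topologicalKrullDim_mono ?_
  rintro _ ⟨q, ⟨hq, hqm⟩, rfl⟩
  refine ⟨?_, ?_⟩
  · exact specializes_iff_mem_closure.1 (hi.isInducing.specializes_iff_le.2 hq)
  · rw [Set.mem_preimage, Set.mem_singleton_iff, hc, hc, hqm]

theorem IsLocallySpecMapOfFiniteType.exists_fiber_add_topologicalKrullDim_le
    [JacobsonSpace X] (hX : IsLocallySpecOfFiniteType k X) (hS : IsLocallySpecOfFiniteType k S)
    (hg : IsLocallySpecMapOfFiniteType k g) (hgc : ∀ x, IsClosed {x} → IsClosed {g x})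
    (ξ : X) {V : Set X} (hV : IsOpen V) (hξ : ξ ∈ V) :
    ∃ x ∈ V, ∃ V' ⊆ V, IsOpen V' ∧ x ∈ V' ∧ ξ ⤳ x ∧ IsClosed {g x} ∧
      topologicalKrullDim (closure {ξ} ∩ g ⁻¹' {g x} ∩ V' : Set X) +
        topologicalKrullDim (closure {g ξ}) ≤ topologicalKrullDim (closure {ξ}) := by
  obtain ⟨A, B, _, _, _, _, _, _, _, _, i, j, hi, hj, hc, ⟨P, rfl⟩, hiV⟩ := hg ξ V hV hξ
  obtain ⟨b, hb, h⟩ := exists_krullDim_fiber_add_le k (A := A) P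
  have hV' : IsOpen (i '' {q : PrimeSpectrum B | b ∉ q.asIdeal}) :=
    hi.isOpenMap _ (PrimeSpectrum.isOpen_setOf_notMem b)
  have hV'V : i '' {q : PrimeSpectrum B | b ∉ q.asIdeal} ⊆ V :=
    (Set.image_subset_range _ _).trans hiV
  -- The Jacobson property supplies a closed point in the locus where the generic bound holds.
  obtain ⟨x, ⟨hxξ, q₀, hq₀, rfl⟩, hx⟩ := nonempty_inter_closedPoints
    (Z := closure {i P} ∩ i '' {q : PrimeSpectrum B | b ∉ q.asIdeal})
    ⟨i P, subset_closure rfl, P, hb, rfl⟩ (isClosed_closure.isLocallyClosed.inter hV'.isLocallyClosed)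
  have hgx := hgc _ hx
  refine ⟨i q₀, hV'V ⟨q₀, hq₀, rfl⟩, _, hV'V, hV', ⟨q₀, hq₀, rfl⟩,
    specializes_iff_mem_closure.2 hxξ, hgx, ?_⟩
  rw [hc] at hgx
  have hm : IsClosed {PrimeSpectrum.comap (algebraMap A B) q₀} := by
    have := hgx.preimage hj.continuous
    rwa [← Set.image_singleton, Set.preimage_image_eq _ hj.injective] at this
  rw [hX.topologicalKrullDim_closure_eq hi, hc, hc, hS.topologicalKrullDim_closure_eq hj]
  refine le_trans (add_le_add ?_ le_rfl) (h _ ((PrimeSpectrum.isClosed_singleton_iff_isMaximal _).1 hm))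
  have hcl : IsLocallyClosed {q : PrimeSpectrum B | P ≤ q ∧ PrimeSpectrum.comap (algebraMap A B) q =
      PrimeSpectrum.comap (algebraMap A B) q₀ ∧ b ∉ q.asIdeal} :=
    P.isClosed_setOf_le.isLocallyClosed.inter
      ((hm.preimage (PrimeSpectrum.continuous_comap _)).isLocallyClosed.inter
        (PrimeSpectrum.isOpen_setOf_notMem b).isLocallyClosed)
  refine le_trans ?_ (PrimeSpectrum.topologicalKrullDim_eq_krullDim _ hcl).le
  rw [← hi.isEmbedding.topologicalKrullDim_image]
  refine topologicalKrullDim_mono ?_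
  rintro _ ⟨⟨hq1, hq2⟩, q, hq, rfl⟩
  refine ⟨q, ⟨?_, ?_, hq⟩, rfl⟩
  · exact hi.isInducing.specializes_iff_le.1 (specializes_iff_mem_closure.2 hq1)
  · rw [Set.mem_preimage, Set.mem_singleton_iff, hc] at hq2
    exact hj.injective hq2

end FiberDim

/-! ### The dimension formula and saturation over closed points -/

section Components

open TopologicalSpace Topology

/-- A constructible set is a finite union of locally closed sets, each of which has a closed point
if nonempty. -/
theorem Topology.IsConstructible.nonempty_inter_closedPoints {S : Type*} [TopologicalSpace S]
    [JacobsonSpace S] {C : Set S} (hC : IsConstructible C) (hne : C.Nonempty) :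
    (C ∩ closedPoints S).Nonempty := by
  have hmem : C ∈ BooleanSubalgebra.closure {U : Set S | IsOpen U} :=
    BooleanSubalgebra.closure_mono (fun U hU => hU.1) hC
  have hsub : IsSublattice {U : Set S | IsOpen U} :=
    ⟨fun U hU V hV => IsOpen.union (s₁ := U) (s₂ := V) hU hV,
      fun U hU V hV => IsOpen.inter (s := U) (t := V) hU hV⟩
  obtain ⟨t, rfl⟩ := (BooleanSubalgebra.mem_closure_iff_sup_sdiff hsub
    (isOpen_empty : IsOpen (∅ : Set S)) (isOpen_univ : IsOpen (Set.univ : Set S))).1 hmem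
  obtain ⟨x, hx⟩ := hne
  rw [Finset.sup_set_eq_biUnion, Set.mem_iUnion₂] at hx
  obtain ⟨p, hp, hx⟩ := hx
  obtain ⟨y, hy, hyc⟩ := _root_.nonempty_inter_closedPoints ⟨x, hx⟩
    ((show IsOpen p.1.1 from p.1.2).isLocallyClosed.inter
      (show IsOpen p.2.1 from p.2.2).isClosed_compl.isLocallyClosed)
  refine ⟨y, ?_, hyc⟩
  rw [Finset.sup_set_eq_biUnion, Set.mem_iUnion₂]
  exact ⟨p, hp, hy⟩

variable {k : Type u} [Field k] {X S : Type u} [TopologicalSpace X] [TopologicalSpace S] {g : X → S}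

theorem closure_image_closure_singleton (hc : Continuous g) (ξ : X) :
    closure (g '' closure {ξ}) = closure {g ξ} := by
  rw [closure_image_closure hc, Set.image_singleton]

/-- For ≥ the fiber must be measured inside an open set `V` of `X` contained in the component: there
the fiber of the component and that of `X` agree. -/
theorem IsLocallySpecMapOfFiniteType.topologicalKrullDim_irreducibleComponent
    [NoetherianSpace X] [JacobsonSpace X] [QuasiSober X]
    (hX : IsLocallySpecOfFiniteType k X) (hS : IsLocallySpecOfFiniteType k S)
    (hg : IsLocallySpecMapOfFiniteType k g) (hc : Continuous g)
    (hgc : ∀ x, IsClosed {x} → IsClosed {g x}) {d : ℕ}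
    (hfib : ∀ s : S, IsClosed ({s} : Set S) →
      IsIrreducible (g ⁻¹' {s}) ∧ topologicalKrullDim ↥(g ⁻¹' {s}) = (d : WithBot ℕ∞))
    {ξ : X} (hξ : closure {ξ} ∈ irreducibleComponents X) :
    topologicalKrullDim (closure {ξ}) = topologicalKrullDim (closure {g ξ}) + d := by
  obtain ⟨V, hV, ⟨y, hy⟩, hVξ⟩ :=
    NoetherianSpace.exists_isOpen_nonempty_subset_irreducibleComponent _ hξ
  have hξV : ξ ∈ V := (specializes_iff_mem_closure.2 (hVξ hy)).mem_open hV hy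
  obtain ⟨x, -, V', hV'V, hV', hxV', hξx, hgx, hdim⟩ :=
    hg.exists_fiber_add_topologicalKrullDim_le hX hS hgc ξ hV hξV
  obtain ⟨hirr, hd⟩ := hfib _ hgx
  have hFc : IsClosed (g ⁻¹' {g x}) := hgx.preimage hc
  obtain ⟨φ, hφ⟩ := QuasiSober.sober hirr hFc
  refine le_antisymm ?_ ?_
  · refine (hg.topologicalKrullDim_le_add_fiber hX hS hξx hgx).trans ?_
    rw [← hd]
    exact add_le_add le_rfl (topologicalKrullDim_mono Set.inter_subset_right)
  · refine le_trans ?_ hdim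
    rw [add_comm, ← hd]
    refine add_le_add ?_ le_rfl
    -- The generic point of the irreducible fiber lies in every open set meeting it, so the part in
    -- `V'` still has dimension `d`.
    have hφV : φ ∈ V' := (hφ.specializes rfl).mem_open hV' hxV'
    rw [← hφ.def, ← hX.topologicalKrullDim_closure_inter_eq φ hV' hφV]
    exact topologicalKrullDim_mono fun z hz => ⟨⟨hVξ (hV'V hz.2), hz.1⟩, hz.2⟩

/-- Otherwise `Z` would cut the irreducible fiber in dimension less than `d`, contradicting the
dimension formula and the lower bound for fibers of `Z`. -/
theorem IsLocallySpecMapOfFiniteType.preimage_singleton_subset_irreducibleComponent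
    [NoetherianSpace X] [JacobsonSpace X] [QuasiSober X]
    (hX : IsLocallySpecOfFiniteType k X) (hS : IsLocallySpecOfFiniteType k S)
    (hg : IsLocallySpecMapOfFiniteType k g) (hc : Continuous g)
    (hgc : ∀ x, IsClosed {x} → IsClosed {g x}) {d : ℕ}
    (hfib : ∀ s : S, IsClosed ({s} : Set S) →
      IsIrreducible (g ⁻¹' {s}) ∧ topologicalKrullDim ↥(g ⁻¹' {s}) = (d : WithBot ℕ∞))
    {Z : Set X} (hZ : Z ∈ irreducibleComponents X) {x : X} (hx : x ∈ Z) (hgx : IsClosed {g x}) :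
    g ⁻¹' {g x} ⊆ Z := by
  have hZc := isClosed_of_mem_irreducibleComponents Z hZ
  obtain ⟨ξ, hξ⟩ := QuasiSober.sober hZ.1 hZc
  obtain rfl := hξ.def
  obtain ⟨hirr, hd⟩ := hfib _ hgx
  by_contra hsub
  have h1 := topologicalKrullDim_add_one_le (G := closure {ξ} ∩ g ⁻¹' {g x}) hirr
    (hZc.inter (hgx.preimage hc))
    ⟨Set.inter_subset_right, fun h => hsub (h.trans Set.inter_subset_left)⟩
  have h2 := hg.topologicalKrullDim_le_add_fiber hX hS (specializes_iff_mem_closure.2 hx) hgx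
  obtain ⟨n, hn⟩ := hS.exists_topologicalKrullDim_closure_eq_natCast (g ξ)
  rw [hg.topologicalKrullDim_irreducibleComponent hX hS hc hgc hfib hZ, hn] at h2
  rw [hd] at h1
  generalize topologicalKrullDim (closure {ξ} ∩ g ⁻¹' {g x} : Set X) = e at h1 h2
  induction e with
  | bot => simp at h2
  | coe e =>
    induction e with
    | top =>
      have : (⊤ : ℕ∞) + 1 ≤ d := by exact_mod_cast h1
      simp at this
    | coe e =>
      have h1' : e + 1 ≤ d := by exact_mod_cast h1
      have h2' : n + d ≤ n + e := by exact_mod_cast h2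
      omega

end Components

/-! ### Topological consequences of saturation -/

section Formal

open TopologicalSpace Topology

variable {X S : Type u} [TopologicalSpace X] [TopologicalSpace S] {g : X → S}

omit [TopologicalSpace X] in
-- A fiber meeting both `Z` and its complement puts a point in the constructible set `g '' Z ∩ g ''
-- Zᶜ`, which then has a closed point.
theorem mem_of_isConstructible_image [JacobsonSpace S]
    {Z : Set X} (h1 : IsConstructible (g '' Z)) (h2 : IsConstructible (g '' Zᶜ))
    (h : ∀ x ∈ Z, IsClosed {g x} → g ⁻¹' {g x} ⊆ Z) {x y : X} (hx : x ∈ Z) (hxy : g y = g x) :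
    y ∈ Z := by
  by_contra hy
  obtain ⟨_, ⟨⟨a, ha, rfl⟩, b, hb, hab⟩, hs⟩ := (h1.inter h2).nonempty_inter_closedPoints
    ⟨g x, ⟨x, hx, rfl⟩, y, hy, hxy⟩
  exact hb (h a ha hs hab)

omit [TopologicalSpace X] in
theorem surjective_of_isConstructible_range [JacobsonSpace S] (h : IsConstructible (Set.range g))
    (hs : ∀ s : S, IsClosed {s} → (g ⁻¹' {s}).Nonempty) : Function.Surjective g := by
  by_contra hsurj
  obtain ⟨s, hs'⟩ := not_forall.1 hsurj
  obtain ⟨s, hs1, hs2⟩ := (isConstructible_compl.2 h).nonempty_inter_closedPoints ⟨s, hs'⟩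
  obtain ⟨x, hx⟩ := hs s hs2
  exact hs1 ⟨x, hx⟩

/-- The generic points of the irreducible components dominating `W` map to the generic point of
`W`. -/
theorem existsUnique_irreducibleComponent_dominating [QuasiSober X] [QuasiSober S] [T0Space S]
    (hc : Continuous g) (hsurj : Function.Surjective g)
    (hsat : ∀ Z ∈ irreducibleComponents X, ∀ x ∈ Z, ∀ y, g y = g x → y ∈ Z)
    {W : Set S} (hW : W ∈ irreducibleComponents S) :
    ∃! Z : Set X, Z ∈ irreducibleComponents X ∧ closure (g '' Z) = W := by
  obtain ⟨η, hη⟩ := QuasiSober.sober hW.1 (isClosed_of_mem_irreducibleComponents W hW)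
  obtain ⟨x, rfl⟩ := hsurj η
  have key : ∀ Z ∈ irreducibleComponents X, closure (g '' Z) = W →
      ∃ ξ, IsGenericPoint ξ Z ∧ g ξ = g x := by
    intro Z hZ hZW
    obtain ⟨ξ, hξ⟩ := QuasiSober.sober hZ.1 (isClosed_of_mem_irreducibleComponents Z hZ)
    refine ⟨ξ, hξ, ?_⟩
    have h1 := hξ.image hc
    rw [hZW] at h1
    exact h1.eq hη
  -- Any component through a point over the generic point of `W` dominates `W`, by maximality of
  -- `W`.
  refine ⟨irreducibleComponent x, ⟨irreducibleComponent_mem_irreducibleComponents x, ?_⟩, ?_⟩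
  · refine (hW.eq_of_le ?_ ?_).symm
    · exact (isIrreducible_irreducibleComponent.image g hc.continuousOn).closure
    · change W ⊆ _
      rw [← hη.def]
      exact closure_mono (Set.singleton_subset_iff.2 ⟨x, mem_irreducibleComponent, rfl⟩)
  · rintro Z ⟨hZ, hZW⟩
    obtain ⟨ξ, hξ, hξx⟩ := key Z hZ hZW
    -- Saturation gives `ξ ∈ irreducibleComponent x`, which forces `Z` into that component.
    have hx : x ∈ Z := hsat Z hZ ξ hξ.mem x hξx.symm
    have hξ' : ξ ∈ irreducibleComponent x := hsat _ (irreducibleComponent_mem_irreducibleComponents x)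
      x mem_irreducibleComponent ξ hξx
    refine hZ.eq_of_le isIrreducible_irreducibleComponent ?_
    change Z ⊆ _
    rw [← hξ.def]
    exact closure_minimal (Set.singleton_subset_iff.2 hξ') isClosed_irreducibleComponent

theorem bijOn_irreducibleComponents
    (hdom : ∀ W ∈ irreducibleComponents S,
      ∃! Z : Set X, Z ∈ irreducibleComponents X ∧ closure (g '' Z) = W)
    (hmaps : ∀ Z ∈ irreducibleComponents X, closure (g '' Z) ∈ irreducibleComponents S) :
    Set.BijOn (fun Z : Set X => closure (g '' Z))
      (irreducibleComponents X) (irreducibleComponents S) := by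
  refine ⟨hmaps, fun Z hZ Z' hZ' h => ?_, fun W hW => ?_⟩
  · exact (hdom _ (hmaps Z hZ)).unique ⟨hZ, rfl⟩ ⟨hZ', h.symm⟩
  · obtain ⟨Z, hZ, -⟩ := hdom W hW
    exact ⟨Z, hZ⟩

theorem exists_irreducibleComponent_subset (hc : Continuous g)
    {Z : Set X} (hZ : Z ∈ irreducibleComponents X) :
    ∃ W ∈ irreducibleComponents S, closure (g '' Z) ⊆ W := by
  have hirr : IsIrreducible (closure (g '' Z)) := (hZ.1.image g hc.continuousOn).closure
  obtain ⟨W, hW, hle, hmax⟩ := exists_preirreducible _ hirr.isPreirreducible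
  refine ⟨W, ⟨⟨hirr.nonempty.mono hle, hW⟩, fun T hT hWT => ?_⟩, hle⟩
  exact (hmax T hT.isPreirreducible hWT).le

/-- The component `Z'` dominating `W` maps onto `W`; being saturated, it contains `Z`, hence equals
it. -/
theorem closure_image_mem_irreducibleComponents_of_isClosedMap (hc : Continuous g)
    (hcl : IsClosedMap g)
    (hsat : ∀ Z ∈ irreducibleComponents X, ∀ x ∈ Z, ∀ y, g y = g x → y ∈ Z)
    (hdom : ∀ W ∈ irreducibleComponents S,
      ∃! Z : Set X, Z ∈ irreducibleComponents X ∧ closure (g '' Z) = W)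
    {Z : Set X} (hZ : Z ∈ irreducibleComponents X) :
    closure (g '' Z) ∈ irreducibleComponents S := by
  obtain ⟨W, hW, hZW⟩ := exists_irreducibleComponent_subset hc hZ
  obtain ⟨Z', ⟨hZ', hZ'W⟩, -⟩ := hdom W hW
  rw [(hcl Z' (isClosed_of_mem_irreducibleComponents Z' hZ')).closure_eq] at hZ'W
  have : Z ⊆ Z' := by
    intro x hx
    obtain ⟨y, hy, hyx⟩ : g x ∈ g '' Z' := hZ'W ▸ hZW (subset_closure ⟨x, hx, rfl⟩)
    exact hsat Z' hZ' y hy x hyx.symm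
  obtain rfl := hZ.eq_of_le hZ'.1 this
  rwa [hZ'W, (isClosed_of_mem_irreducibleComponents W hW).closure_eq]

end Formal

/-! ### Affine charts of schemes and going down at flat points -/

section Schemes

open TopologicalSpace Topology

theorem isLocallySpecMapOfFiniteType_of_locallyOfFiniteType (k : Type u) [Field k]
    {X S : Scheme.{u}} (g : X ⟶ S) (pS : S ⟶ Spec (CommRingCat.of k))
    [LocallyOfFiniteType pS] [LocallyOfFiniteType (g ≫ pS)] :
    IsLocallySpecMapOfFiniteType k g := by
  intro x V hV hx
  obtain ⟨U, hU, hxU, -⟩ := exists_isAffineOpen_mem_and_subset (Opens.mem_top (g x))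
  obtain ⟨T, hT, hxT, hTV⟩ := exists_isAffineOpen_mem_and_subset
    (U := ⟨V, hV⟩ ⊓ g ⁻¹ᵁ U) ⟨hx, hxU⟩
  have hTU : T ≤ g ⁻¹ᵁ U := fun y hy => (hTV hy).2
  obtain ⟨a, ha⟩ := Spec.map_surjective (hU.fromSpec ≫ pS)
  have hb : Spec.map (a ≫ g.appLE U T hTU) = hT.fromSpec ≫ g ≫ pS := by
    rw [Spec.map_comp, ha, hU.SpecMap_appLE_fromSpec_assoc g hT hTU]
  have hfa : a.hom.FiniteType :=
    (HasRingHomProperty.Spec_iff (P := @LocallyOfFiniteType)).1 (ha ▸ inferInstance)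
  have hfb : (a ≫ g.appLE U T hTU).hom.FiniteType :=
    (HasRingHomProperty.Spec_iff (P := @LocallyOfFiniteType)).1 (hb ▸ inferInstance)
  let : Algebra k Γ(S, U) := a.hom.toAlgebra
  let : Algebra k Γ(X, T) := (a ≫ g.appLE U T hTU).hom.toAlgebra
  let : Algebra Γ(S, U) Γ(X, T) := (g.appLE U T hTU).hom.toAlgebra
  refine ⟨Γ(S, U), Γ(X, T), inferInstance, inferInstance, inferInstance, inferInstance, inferInstance,
    IsScalarTower.of_algebraMap_eq fun _ => rfl, hfa, hfb, hT.fromSpec, hU.fromSpec,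
    hT.fromSpec.isOpenEmbedding, hU.fromSpec.isOpenEmbedding, fun q => ?_, ?_, ?_⟩
  · have := congrArg (fun f => f q) (hU.SpecMap_appLE_fromSpec g hT hTU)
    exact this.symm
  · exact hT.range_fromSpec.symm ▸ hxT
  · exact hT.range_fromSpec.subset.trans fun y hy => (hTV hy).1

theorem isLocallySpecOfFiniteType_of_locallyOfFiniteType (k : Type u) [Field k]
    {X : Scheme.{u}} (pX : X ⟶ Spec (CommRingCat.of k)) [LocallyOfFiniteType pX] :
    IsLocallySpecOfFiniteType k X := by
  intro x
  have : LocallyOfFiniteType (𝟙 X ≫ pX) := by rwa [Category.id_comp]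
  obtain ⟨A, B, _, _, _, _, _, _, _, hB, i, j, hi, -, -, hx, -⟩ :=
    isLocallySpecMapOfFiniteType_of_locallyOfFiniteType k (𝟙 X) pX x Set.univ isOpen_univ trivial
  exact ⟨B, _, _, hB, i, hi, hx⟩

/-- Generizations of a point are the image of the spectrum of its local ring, and flat local
homomorphisms satisfy going down. -/
theorem IsFlatAt.exists_specializes {X S : Scheme.{u}} {g : X ⟶ S} {x : X} (h : IsFlatAt g x)
    {ξ : X} (hξ : ξ ⤳ x) {η : S} (hη : η ⤳ g ξ) : ∃ ξ' : X, ξ' ⤳ ξ ∧ g ξ' = η := by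
  obtain ⟨q, rfl⟩ : ξ ∈ Set.range (X.fromSpecStalk x) := by rwa [Scheme.range_fromSpecStalk]
  obtain ⟨p, rfl⟩ : η ∈ Set.range (S.fromSpecStalk (g x)) := by
    rw [Scheme.range_fromSpecStalk]
    exact hη.trans (hξ.map g.continuous)
  have hcomm : ∀ q, S.fromSpecStalk (g x) (Spec.map (g.stalkMap x) q) = g (X.fromSpecStalk x q) :=
    fun q => congrArg (fun f => f q) (Scheme.SpecMap_stalkMap_fromSpecStalk (f := g) (x := x))
  rw [← hcomm, (S.fromSpecStalk (g x)).isEmbedding.isInducing.specializes_iff] at hη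
  let := (g.stalkMap x).hom.toAlgebra
  have hflat : Module.Flat (S.presheaf.stalk (g x)) (X.presheaf.stalk x) := h
  have hgd := Algebra.HasGoingDown.iff_generalizingMap_primeSpectrumComap.1
    (Algebra.HasGoingDown.of_flat (R := S.presheaf.stalk (g x)) (S := X.presheaf.stalk x))
  obtain ⟨q', hq', hq'p⟩ := hgd hη
  refine ⟨X.fromSpecStalk x q', hq'.map (X.fromSpecStalk x).continuous, ?_⟩
  exact (hcomm q').symm.trans (congrArg (S.fromSpecStalk (g x)) hq'p)

end Schemes

/-! ### The main theorem -/

theorem propositionv2p1 (k : Type u) [Field k] [IsAlgClosed k] {X S : Scheme.{u}}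
    (pX : X ⟶ Spec (CommRingCat.of k)) (pS : S ⟶ Spec (CommRingCat.of k))
    (hX : IsAlgebraicVariety k pX) (hS : IsAlgebraicVariety k pS)
    (g : X ⟶ S) (hg : g ≫ pS = pX) (d : ℕ) (hd : 1 ≤ d)
    (hfib : ∀ s : S, IsClosed ({s} : Set S) →
      IsIrreducible (g ⁻¹' {s}) ∧ topologicalKrullDim ↥(g ⁻¹' {s}) = (d : WithBot ℕ∞)) :
    -- every component of `S` is dominated by a unique component of `X`
    (∀ W ∈ irreducibleComponents S, ∃! Z : Set X, Z ∈ irreducibleComponents X ∧ Dominates g Z W) ∧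
    -- every component of `X` is a union of fibers
    (∀ Z ∈ irreducibleComponents X, IsUnionOfFibers g Z) ∧
    -- (a) `g` is closed
    (IsClosedMap g →
      Set.BijOn (fun Z : Set X => closure (g '' Z))
        (irreducibleComponents X) (irreducibleComponents S) ∧
      Set.BijOn (fun W : Set S => g ⁻¹' W)
        (irreducibleComponents S) (irreducibleComponents X) ∧
      Set.InvOn (fun W : Set S => g ⁻¹' W) (fun Z : Set X => closure (g '' Z))
        (irreducibleComponents X) (irreducibleComponents S)) ∧
    -- (b) all components of `X` have the same dimension
    ((∀ Z ∈ irreducibleComponents X, ∀ Z' ∈ irreducibleComponents X,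
        topologicalKrullDim ↥Z = topologicalKrullDim ↥Z') →
      Set.BijOn (fun Z : Set X => closure (g '' Z))
        (irreducibleComponents X) (irreducibleComponents S)) ∧
    -- (c) every component of `X` contains a point at which `g` is flat
    ((∀ Z ∈ irreducibleComponents X, ∃ x ∈ Z, IsFlatAt g x) →
      Set.BijOn (fun Z : Set X => closure (g '' Z))
        (irreducibleComponents X) (irreducibleComponents S)) := by
  subst hg
  have := hX.locallyOfFiniteType
  have := hX.quasiCompact
  have := hS.locallyOfFiniteType
  have := hS.quasiCompact
  have : LocallyOfFiniteType g := locallyOfFiniteType_of_comp g pS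
  have : IsLocallyNoetherian S := LocallyOfFiniteType.isLocallyNoetherian pS
  have : IsLocallyNoetherian X := LocallyOfFiniteType.isLocallyNoetherian (g ≫ pS)
  have : CompactSpace S := QuasiCompact.compactSpace_of_compactSpace pS
  have : CompactSpace X := QuasiCompact.compactSpace_of_compactSpace (g ≫ pS)
  have : IsNoetherian S := {}
  have : IsNoetherian X := {}
  have : JacobsonSpace S := LocallyOfFiniteType.jacobsonSpace pS
  have : JacobsonSpace X := LocallyOfFiniteType.jacobsonSpace (g ≫ pS)
  have hgX := isLocallySpecMapOfFiniteType_of_locallyOfFiniteType k g pS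
  have hlX := isLocallySpecOfFiniteType_of_locallyOfFiniteType k (g ≫ pS)
  have hlS := isLocallySpecOfFiniteType_of_locallyOfFiniteType k pS
  have hc : Continuous g := g.continuous
  have hgc : ∀ x : X, IsClosed {x} → IsClosed {g x} := fun x hx =>
    g.closePoints_subset_preimage_closedPoints hx
  have hcons : ∀ U : Set X, IsOpen U → Topology.IsConstructible (g '' U) := fun U hU =>
    g.isConstructible_image ((TopologicalSpace.NoetherianSpace.isCompact U).isConstructible hU)
  have hcons' : ∀ Z : Set X, IsClosed Z → Topology.IsConstructible (g '' Z) := fun Z hZ =>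
    g.isConstructible_image (Topology.isConstructible_compl.1
      ((TopologicalSpace.NoetherianSpace.isCompact Zᶜ).isConstructible hZ.isOpen_compl))
  have hclX : ∀ Z ∈ irreducibleComponents X, IsClosed Z := fun Z hZ =>
    isClosed_of_mem_irreducibleComponents Z hZ
  have hclS : ∀ W ∈ irreducibleComponents S, IsClosed W := fun W hW =>
    isClosed_of_mem_irreducibleComponents W hW
  have hsurj : Function.Surjective g := surjective_of_isConstructible_range
    (by rw [← Set.image_univ]; exact hcons _ isOpen_univ) fun s hs => (hfib s hs).1.nonempty
  have hsat : ∀ Z ∈ irreducibleComponents X, ∀ x ∈ Z, ∀ y, g y = g x → y ∈ Z :=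
    fun Z hZ x hx y hxy => mem_of_isConstructible_image (hcons' Z (hclX Z hZ))
      (hcons _ (hclX Z hZ).isOpen_compl) (fun x hx hgx =>
        hgX.preimage_singleton_subset_irreducibleComponent hlX hlS hc hgc hfib hZ hx hgx) hx hxy
  have hdom : ∀ W ∈ irreducibleComponents S,
      ∃! Z : Set X, Z ∈ irreducibleComponents X ∧ closure (g '' Z) = W :=
    fun W hW => existsUnique_irreducibleComponent_dominating hc hsurj hsat hW
  have hpre : ∀ Z ∈ irreducibleComponents X, g ⁻¹' (g '' Z) = Z := fun Z hZ =>
    Set.Subset.antisymm (fun y ⟨x, hx, hxy⟩ => hsat Z hZ x hx y hxy.symm)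
      (Set.subset_preimage_image g Z)
  refine ⟨hdom, fun Z hZ => ⟨g '' Z, ?_⟩, fun hcl => ?_, fun hdim => ?_, fun hflat => ?_⟩
  · rw [← Set.preimage_iUnion₂, Set.biUnion_of_singleton, hpre Z hZ]
  · have hbij := bijOn_irreducibleComponents hdom fun Z hZ =>
      closure_image_mem_irreducibleComponents_of_isClosedMap hc hcl hsat hdom hZ
    have hinv : Set.InvOn (fun W : Set S => g ⁻¹' W) (fun Z : Set X => closure (g '' Z))
        (irreducibleComponents X) (irreducibleComponents S) := by
      refine ⟨fun Z hZ => ?_, fun W hW => ?_⟩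
      · change g ⁻¹' closure (g '' Z) = Z
        rw [(hcl Z (hclX Z hZ)).closure_eq, hpre Z hZ]
      · change closure (g '' (g ⁻¹' W)) = W
        rw [Set.image_preimage_eq W hsurj, (hclS W hW).closure_eq]
    refine ⟨hbij, hinv.symm.bijOn ?_ hbij.mapsTo, hinv⟩
    intro W hW
    obtain ⟨Z, hZ, rfl⟩ := hbij.surjOn hW
    change g ⁻¹' closure (g '' Z) ∈ _
    rwa [(hcl Z (hclX Z hZ)).closure_eq, hpre Z hZ]
  · refine bijOn_irreducibleComponents hdom fun Z hZ => ?_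
    obtain ⟨W, hW, hZW⟩ := exists_irreducibleComponent_subset hc hZ
    obtain ⟨Z', ⟨hZ', hZ'W⟩, -⟩ := hdom W hW
    suffices closure (g '' Z) = W by rwa [this]
    by_contra hne
    -- Failure to dominate `W` would make the image strictly smaller in dimension, while equal
    -- dimensions of `Z` and `Z'` give equal dimensions after subtracting `d`.
    have hlt := topologicalKrullDim_add_one_le hW.1 isClosed_closure
      (hZW.ssubset_of_ne hne)
    have hdd := hdim Z hZ Z' hZ'
    obtain ⟨ξ, hξ⟩ := QuasiSober.sober hZ.1 (hclX Z hZ)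
    obtain ⟨ξ', hξ'⟩ := QuasiSober.sober hZ'.1 (hclX Z' hZ')
    obtain rfl := hξ.def
    obtain rfl := hξ'.def
    rw [closure_image_closure_singleton hc] at hZ'W hlt
    rw [hgX.topologicalKrullDim_irreducibleComponent hlX hlS hc hgc hfib hZ,
      hgX.topologicalKrullDim_irreducibleComponent hlX hlS hc hgc hfib hZ', hZ'W] at hdd
    obtain ⟨n, hn⟩ := hlS.exists_topologicalKrullDim_closure_eq_natCast (g ξ)
    obtain ⟨n', hn'⟩ := hlS.exists_topologicalKrullDim_closure_eq_natCast (g ξ')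
    rw [hZ'W] at hn'
    rw [hn, hn'] at hlt hdd
    have h1 : n + 1 ≤ n' := by exact_mod_cast hlt
    have h2 : n + d = n' + d := by exact_mod_cast hdd
    omega
  · refine bijOn_irreducibleComponents hdom fun Z hZ => ?_
    obtain ⟨W, hW, hZW⟩ := exists_irreducibleComponent_subset hc hZ
    obtain ⟨x, hx, hfx⟩ := hflat Z hZ
    obtain ⟨ξ, hξ⟩ := QuasiSober.sober hZ.1 (hclX Z hZ)
    obtain ⟨η, hη⟩ := QuasiSober.sober hW.1 (hclS W hW)
    obtain ⟨ξ', hξ', hgξ'⟩ := hfx.exists_specializes (hξ.specializes hx)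
      (hη.specializes (hZW (subset_closure ⟨ξ, hξ.mem, rfl⟩)))
    -- The lift `ξ'` of `η` specializes to the generic point of the component `Z`, so its closure
    -- cannot be larger than `Z`.
    have hZξ' : Z = closure {ξ'} := by
      refine hZ.eq_of_le isIrreducible_singleton.closure ?_
      change Z ⊆ _
      rw [← hξ.def]
      exact hξ'.closure_subset
    rw [hZξ', closure_image_closure_singleton hc, hgξ', hη.def]
    exact hW
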